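/- Let $\mathbb K$ be a commutative ring and $\log=\log_2$. A polynomial has size $n$ if its degree is at most $n-1$. Algorithms run on an algebraic random access machine: a storage location holds an element of $\mathbb K$ or a pointer, time is the number of operations in $\mathbb K$, the input is read only, the output space can be read and written, and the extra space is the number of all other locations that may be written. Let $\mathsf M:\mathbb N\to\mathbb R_{\ge 0}$ be a cost function (a bound for the multiplication of two size-$n$ polynomials) such that $\alpha\,\mathsf M(n)\le \mathsf M(\alpha n)$ for all real $\alpha\ge 1$ and $n\ge1$ with $\alpha n\in\mathbb N$, and $n\log n=O(\mathsf M(n)\log\log n)$. Let $\lambda_s,c_s\ge 0$ be real constants (the short product of two size-$n$ polynomials takes time $\lambda_s\mathsf M(n)$ and space $c_sn$). Algorithm InPlaceEval uses, as a required subroutine, an algorithm $\mathrm{Eval}$ for unbalanced multipoint evaluation: for all $1\le k\le n$, given $F\in\mathbb K[X]$ of size $n$ and $b_1,\dots,b_k\in\mathbb K$, it computes $F(b_1),\dots,F(b_k)$ using $$2\lambda_s\mathsf M(n)+4\,\mathsf M(k)\log k+O\bigl(n+\mathsf M(k)\log\log k\bigr)$$ operations in $\mathbb K$ and at most $(c_s+2)k$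 extra memory words, besides a constant number of registers. On input $F\in\mathbb K[X]$ of size $n\ge 1$ and $(a_0,\dots,a_{n-1})\in\mathbb K^n$, with output space $R_{[0..n[}$, InPlaceEval does the following: 1. $s\gets 0$, $k\gets\lfloor n/(c_s+3)\rfloor$. 2. While $k>0$: $R_{[s..s+k[}\gets \mathrm{Eval}(F,a_s,\dots,a_{s+k-1})$ with $R_{[s+k..n[}$ as work space; then $s\gets s+k$ and $k\gets\lfloor (n-s)/(c_s+3)\rfloor$. 3. $R_{[s..n[}\gets \mathrm{Eval}(F,a_s,\dots,a_{n-1})$. **Theorem.** For every such $\mathrm{Eval}$, Algorithm InPlaceEval is correct, that is, it returns $R=(F(a_0),\dots,F(a_{n-1}))$. It uses $O(1)$ extra space, and $$\left(4+\frac{2\lambda_s}{\log\frac{c_s+3}{c_s+2}}\right)\mathsf M(n)\log n+O\bigl(\mathsf M(n)\log\log n\bigr)$$ operations in $\mathbb K$, as $n\to\infty$, uniformly in $F$ and the points. -/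

import Mathlib

/-! An algebraic random access machine over a coefficient ring `K`.

A storage location (register or memory word) holds either a ring element or a pointer (a natural
number). Inputs are read only, the output area may be read and written, and every other location
that a program may write counts as extra space. Time is the number of operations in `K`. -/

namespace InPlace

/-- Storage locations: registers, named by the program text, and memory words, reached through a
pointer held in a register. -/
inductive Loc : Type
  | reg (i : ℕ)
  | word (a : ℕ)
deriving DecidableEq

/-- The content of all locations: a ring element (`Sum.inl`) or a pointer (`Sum.inr`). -/
abbrev State (K : Type*) := Loc → K ⊕ ℕ

/-- Expressions on pointers and counters. `floorDiv e d` is `⌊e / d⌋`. -/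
inductive IdxExpr : Type
  | const (v : ℕ)
  | reg (i : ℕ)
  | add (e f : IdxExpr)
  | sub (e f : IdxExpr)
  | mul (e f : IdxExpr)
  | floorDiv (e : IdxExpr) (d : ℝ)

/-- The value of a pointer expression; `none` if one of its registers holds a ring element. -/
noncomputable def IdxExpr.eval {K : Type*} (σ : State K) : IdxExpr → Option ℕ
  | .const v => some v
  | .reg i => (σ (.reg i)).getRight?
  | .add e f => Option.map₂ (fun x y => x + y) (e.eval σ) (f.eval σ)
  | .sub e f => Option.map₂ (fun x y => x - y) (e.eval σ) (f.eval σ)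
  | .mul e f => Option.map₂ (fun x y => x * y) (e.eval σ) (f.eval σ)
  | .floorDiv e d => (e.eval σ).map (fun x => ⌊(x : ℝ) / d⌋₊)

/-- Operands: register `i`, or the memory word whose address is in register `i`. -/
inductive Opd : Type
  | reg (i : ℕ)
  | ind (i : ℕ)

/-- The location an operand denotes. -/
def Opd.loc {K : Type*} (σ : State K) : Opd → Option Loc
  | .reg i => some (.reg i)
  | .ind i => (σ (.reg i)).getRight?.map Loc.word

/-- The ring element an operand holds; `none` if there is none. -/
def Opd.elt {K : Type*} (σ : State K) (x : Opd) : Option K :=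
  (x.loc σ).bind (fun l => (σ l).getLeft?)

/-- The operations in the coefficient ring. -/
inductive RingOp : Type
  | add
  | sub
  | mul
  | div

/-- The result of an operation. Division is only ever executed for a unit `y`. -/
noncomputable def RingOp.apply {K : Type*} [CommRing K] : RingOp → K → K → K
  | .add, x, y => x + y
  | .sub, x, y => x - y
  | .mul, x, y => x * y
  | .div, x, y => x * Ring.inverse y

/-- Programs. -/
inductive Prog (K : Type*) : Type _
  | skip
  | idx (i : ℕ) (e : IdxExpr)
  | move (dst src : Opd)
  | const (dst : Opd) (x : K)
  | op (o : RingOp) (dst x y : Opd)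
  | seq (p q : Prog K)
  | ifLt (e f : IdxExpr) (p q : Prog K)
  | ifZero (x : Opd) (p q : Prog K)
  | whileLt (e f : IdxExpr) (p : Prog K)

/-- Sequential composition of a list of programs. -/
def block {K : Type*} (l : List (Prog K)) : Prog K := l.foldr Prog.seq Prog.skip

/-- `Exec W L p σ t σ'`: started in state `σ`, the program `p` halts in state `σ'` after `t`
operations in `K` (arithmetic operations and zero tests). Every single write goes to a location in
`W`, and every pointer that is computed and stored is at most `L`; a program that violates this
has no execution. -/
inductive Exec {K : Type*} [CommRing K] (W : Set Loc) (L : ℕ) :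
    Prog K → State K → ℕ → State K → Prop
  | skip (σ : State K) : Exec W L .skip σ 0 σ
  | idx (σ : State K) (i : ℕ) (e : IdxExpr) (v : ℕ) (he : e.eval σ = some v) (hL : v ≤ L)
      (hW : Loc.reg i ∈ W) :
      Exec W L (.idx i e) σ 0 (Function.update σ (.reg i) (.inr v))
  | move (σ : State K) (dst src : Opd) (l l' : Loc) (hd : dst.loc σ = some l)
      (hs : src.loc σ = some l') (hW : l ∈ W) :
      Exec W L (.move dst src) σ 0 (Function.update σ l (σ l'))
  | const (σ : State K) (dst : Opd) (x : K) (l : Loc) (hd : dst.loc σ = some l) (hW : l ∈ W) :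
      Exec W L (.const dst x) σ 0 (Function.update σ l (.inl x))
  | op (σ : State K) (o : RingOp) (dst x y : Opd) (l : Loc) (u v : K) (hd : dst.loc σ = some l)
      (hx : x.elt σ = some u) (hy : y.elt σ = some v) (hdiv : o = .div → IsUnit v) (hW : l ∈ W) :
      Exec W L (.op o dst x y) σ 1 (Function.update σ l (.inl (o.apply u v)))
  | seq (σ₁ σ₂ σ₃ : State K) (p q : Prog K) (t₁ t₂ : ℕ) (hp : Exec W L p σ₁ t₁ σ₂)
      (hq : Exec W L q σ₂ t₂ σ₃) : Exec W L (.seq p q) σ₁ (t₁ + t₂) σ₃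
  | ifLt_true (σ σ' : State K) (e f : IdxExpr) (p q : Prog K) (t x y : ℕ) (he : e.eval σ = some x)
      (hf : f.eval σ = some y) (hxy : x < y) (hp : Exec W L p σ t σ') :
      Exec W L (.ifLt e f p q) σ t σ'
  | ifLt_false (σ σ' : State K) (e f : IdxExpr) (p q : Prog K) (t x y : ℕ) (he : e.eval σ = some x)
      (hf : f.eval σ = some y) (hxy : ¬ x < y) (hq : Exec W L q σ t σ') :
      Exec W L (.ifLt e f p q) σ t σ'
  | ifZero_true (σ σ' : State K) (x : Opd) (p q : Prog K) (t : ℕ) (u : K) (hx : x.elt σ = some u)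
      (hu : u = 0) (hp : Exec W L p σ t σ') : Exec W L (.ifZero x p q) σ (t + 1) σ'
  | ifZero_false (σ σ' : State K) (x : Opd) (p q : Prog K) (t : ℕ) (u : K) (hx : x.elt σ = some u)
      (hu : u ≠ 0) (hq : Exec W L q σ t σ') : Exec W L (.ifZero x p q) σ (t + 1) σ'
  | while_true (σ₁ σ₂ σ₃ : State K) (e f : IdxExpr) (p : Prog K) (t₁ t₂ x y : ℕ)
      (he : e.eval σ₁ = some x) (hf : f.eval σ₁ = some y) (hxy : x < y)
      (hp : Exec W L p σ₁ t₁ σ₂) (hrest : Exec W L (.whileLt e f p) σ₂ t₂ σ₃) :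
      Exec W L (.whileLt e f p) σ₁ (t₁ + t₂) σ₃
  | while_false (σ : State K) (e f : IdxExpr) (p : Prog K) (x y : ℕ) (he : e.eval σ = some x)
      (hf : f.eval σ = some y) (hxy : ¬ x < y) : Exec W L (.whileLt e f p) σ 0 σ

/-- The `len` memory words from address `p` on. -/
def area (p len : ℕ) : Set Loc := {l | ∃ i < len, l = .word (p + i)}

/-- The registers with index at least `lo` and below `hi`. -/
def regs (lo hi : ℕ) : Set Loc := {l | ∃ i, lo ≤ i ∧ i < hi ∧ l = .reg i}

/-- The calling convention of multipoint evaluation: the size-`n` polynomial `F` lies at address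
`pF`, the points `a 0, …, a (k - 1)` at `pA`, the output area of `k` words is at `pO` and a work
area of `w` words at `pW`. Neither output nor work area meets the inputs or the other. Registers
`0` to `5` hold `n`, `k` and the four addresses. All areas lie below the address bound `L`.
Nothing is said about any other content. -/
structure IsEvalCall {K : Type*} [CommRing K] (F : Polynomial K) (a : ℕ → K)
    (n k w pF pA pO pW L : ℕ) (σ : State K) : Prop where
  size : F.degree < n
  reg_n : σ (.reg 0) = .inr n
  reg_k : σ (.reg 1) = .inr k
  reg_F : σ (.reg 2) = .inr pF
  reg_A : σ (.reg 3) = .inr pA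
  reg_O : σ (.reg 4) = .inr pO
  reg_W : σ (.reg 5) = .inr pW
  coeffs : ∀ i < n, σ (.word (pF + i)) = .inl (F.coeff i)
  points : ∀ i < k, σ (.word (pA + i)) = .inl (a i)
  out_work : Disjoint (area pO k) (area pW w)
  readOnly : Disjoint (area pO k ∪ area pW w) (area pF n ∪ area pA k)
  bound_F : pF + n ≤ L
  bound_A : pA + k ≤ L
  bound_O : pO + k ≤ L
  bound_W : pW + w ≤ L

/-- `P` evaluates every size-`n` polynomial at any `k` points with at most `T` operations in `K`,
writing only to the output area, to `w` extra memory words, and to the registers `lo`, …, `hi - 1`.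
-/
def Evaluates {K : Type*} [CommRing K] (P : Prog K) (lo hi n k w : ℕ) (T : ℝ) : Prop :=
  ∀ (F : Polynomial K) (a : ℕ → K) (pF pA pO pW L : ℕ) (σ : State K),
    IsEvalCall F a n k w pF pA pO pW L σ →
    ∃ (t : ℕ) (σ' : State K),
      Exec (area pO k ∪ area pW w ∪ regs lo hi) L P σ t σ' ∧
      (∀ i < k, σ' (.word (pO + i)) = .inl (F.eval (a i))) ∧
      (t : ℝ) ≤ T

/-- In-place multipoint evaluation of a size-`n` polynomial at `n` points, with the subroutine
`Eval` for unbalanced multipoint evaluation. Registers `0` to `5` are the arguments of `Eval`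
(`n`, `k`, polynomial, points, output area, work area); register `6` is `s`, and the registers
`7`, `8`, `9` keep the addresses of the points, of the output `R` and of the extra words:

* `s ← 0`, `k ← ⌊n / (c + 3)⌋`;
* while `k > 0`: `R[s..s+k[ ← Eval(F, a[s..s+k[)` with work space `R[s+k..n[`; then `s ← s + k`,
  `k ← ⌊(n - s) / (c + 3)⌋`;
* `R[s..n[ ← Eval(F, a[s..n[)` with the extra words as work space. -/
noncomputable def inPlaceEval {K : Type*} (c : ℝ) (Eval : Prog K) : Prog K :=
  block [
    .idx 7 (.reg 3),
    .idx 8 (.reg 4),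
    .idx 9 (.reg 5),
    .idx 6 (.const 0),
    .idx 1 (.floorDiv (.reg 0) (c + 3)),
    .whileLt (.const 0) (.reg 1) (block [
      .idx 3 (.add (.reg 7) (.reg 6)),
      .idx 4 (.add (.reg 8) (.reg 6)),
      .idx 5 (.add (.add (.reg 8) (.reg 6)) (.reg 1)),
      Eval,
      .idx 6 (.add (.reg 6) (.reg 1)),
      .idx 1 (.floorDiv (.sub (.reg 0) (.reg 6)) (c + 3))]),
    .idx 1 (.sub (.reg 0) (.reg 6)),
    .idx 3 (.add (.reg 7) (.reg 6)),
    .idx 4 (.add (.reg 8) (.reg 6)),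
    .idx 5 (.reg 9),
    Eval]

end InPlace

namespace InPlace

variable {K : Type*} [CommRing K]

/-! While `m` values are missing, the last `m` output words are free. A round fills `k = ⌊m / (c +
3)⌋` of them, and the other `m - k ≥ (c + 2) k` words hold the work space of `Eval`
(`add_floor_le`), so the loop needs no extra words. It stops once `m < c + 3`, and then a work space
of constant size suffices for the last call.

Up to rounding, each round multiplies `m` by `(c + 2) / (c + 3)`, so there are `log n / log ((c + 3)
/ (c + 2)) + O(1)` rounds (`roundBound_step`, `roundBound_le`). By superlinearity a call at `k`
points costs at most `D + G * k`, with `D` and `G` depending only on `n` (`cost_le_affine`). The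
term `D`, essentially `2 * lam * M n`, is paid once per call; the numbers `k` add up to `n`, so the
rest totals `G * n`, with main term `4 * M n * log n`. The error `n log n` coming from `D` is
absorbed by the growth hypothesis on `M`. -/

/-! ### Executions, write sets and memory areas. -/

theorem Exec.mono {W W' : Set Loc} {L : ℕ} {p : Prog K} {σ σ' : State K} {t : ℕ}
    (h : Exec W L p σ t σ') (hWW : W ⊆ W') : Exec W' L p σ t σ' := by
  induction h with
  | skip σ => exact .skip σ
  | idx σ i e v he hL hW => exact .idx σ i e v he hL (hWW hW)
  | move σ dst src l l' hd hs hW => exact .move σ dst src l l' hd hs (hWW hW)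
  | const σ dst x l hd hW => exact .const σ dst x l hd (hWW hW)
  | op σ o dst x y l u v hd hx hy hdiv hW =>
    exact .op σ o dst x y l u v hd hx hy hdiv (hWW hW)
  | seq σ₁ σ₂ σ₃ p q t₁ t₂ _ _ ihp ihq => exact .seq σ₁ σ₂ σ₃ p q t₁ t₂ ihp ihq
  | ifLt_true σ σ' e f p q t x y he hf hxy _ ih =>
    exact .ifLt_true σ σ' e f p q t x y he hf hxy ih
  | ifLt_false σ σ' e f p q t x y he hf hxy _ ih =>
    exact .ifLt_false σ σ' e f p q t x y he hf hxy ih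
  | ifZero_true σ σ' x p q t u hx hu _ ih => exact .ifZero_true σ σ' x p q t u hx hu ih
  | ifZero_false σ σ' x p q t u hx hu _ ih => exact .ifZero_false σ σ' x p q t u hx hu ih
  | while_true σ₁ σ₂ σ₃ e f p t₁ t₂ x y he hf hxy _ _ ihp ihr =>
    exact .while_true σ₁ σ₂ σ₃ e f p t₁ t₂ x y he hf hxy ihp ihr
  | while_false σ e f p x y he hf hxy => exact .while_false σ e f p x y he hf hxy

/-- An execution leaves every location outside its write set unchanged. -/
theorem Exec.frame {W : Set Loc} {L : ℕ} {p : Prog K} {σ σ' : State K} {t : ℕ}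
    (h : Exec W L p σ t σ') {l : Loc} (hl : l ∉ W) : σ' l = σ l := by
  induction h with
  | skip | while_false => rfl
  | idx _ _ _ _ _ _ hW | move _ _ _ _ _ _ _ hW | const _ _ _ _ _ hW
  | op _ _ _ _ _ _ _ _ _ _ _ _ hW =>
    exact Function.update_of_ne (by rintro rfl; exact hl hW) _ _
  | seq _ _ _ _ _ _ _ _ _ ihp ihq => exact ihq.trans ihp
  | ifLt_true _ _ _ _ _ _ _ _ _ _ _ _ _ ih => exact ih
  | ifLt_false _ _ _ _ _ _ _ _ _ _ _ _ _ ih => exact ih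
  | ifZero_true _ _ _ _ _ _ _ _ _ _ ih => exact ih
  | ifZero_false _ _ _ _ _ _ _ _ _ _ ih => exact ih
  | while_true _ _ _ _ _ _ _ _ _ _ _ _ _ _ _ ihp ihr => exact ihr.trans ihp

theorem Exec.idx_seq {W : Set Loc} {L : ℕ} {q : Prog K} {σ σ' : State K} {t i v : ℕ}
    {e : IdxExpr} (he : e.eval σ = some v) (hL : v ≤ L) (hW : Loc.reg i ∈ W)
    (h : Exec W L q (Function.update σ (.reg i) (.inr v)) t σ') :
    Exec W L (.seq (.idx i e) q) σ t σ' := by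
  simpa using Exec.seq _ _ _ _ _ 0 t (.idx σ i e v he hL hW) h

theorem word_mem_area {x p len : ℕ} : Loc.word x ∈ area p len ↔ p ≤ x ∧ x < p + len := by
  simp only [area, Set.mem_ofPred_eq, Loc.word.injEq]
  constructor
  · rintro ⟨i, hi, rfl⟩; omega
  · rintro ⟨h₁, h₂⟩; exact ⟨x - p, by omega, by omega⟩

theorem reg_notMem_area {i p len : ℕ} : Loc.reg i ∉ area p len := by
  simp [area]

theorem word_notMem_regs {x lo hi : ℕ} : Loc.word x ∉ regs lo hi := by
  simp [regs]

theorem reg_mem_regs {i lo hi : ℕ} : Loc.reg i ∈ regs lo hi ↔ lo ≤ i ∧ i < hi := by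
  simp [regs]

theorem area_subset {p q m n : ℕ} (h₁ : q ≤ p) (h₂ : p + m ≤ q + n) : area p m ⊆ area q n := by
  rintro _ ⟨i, hi, rfl⟩
  exact word_mem_area.2 ⟨by omega, by omega⟩

theorem area_disjoint_of_le {p q m n : ℕ} (h : p + m ≤ q) : Disjoint (area p m) (area q n) := by
  rw [Set.disjoint_left]
  rintro _ ⟨i, hi, rfl⟩ h'
  have := word_mem_area.1 h'
  omega

/-! ### The invariant and a single call of `Eval`. -/

/-- The invariant of in-place evaluation: the first `s` values have been computed. -/
structure Progress (F : Polynomial K) (a : ℕ → K) (n s pF pA pO pW : ℕ) (σ : State K) : Prop where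
  reg_n : σ (.reg 0) = .inr n
  reg_F : σ (.reg 2) = .inr pF
  reg_s : σ (.reg 6) = .inr s
  reg_A : σ (.reg 7) = .inr pA
  reg_O : σ (.reg 8) = .inr pO
  reg_W : σ (.reg 9) = .inr pW
  coeffs : ∀ i < n, σ (.word (pF + i)) = .inl (F.coeff i)
  points : ∀ i < n, σ (.word (pA + i)) = .inl (a i)
  values : ∀ i < s, σ (.word (pO + i)) = .inl (F.eval (a i))

/-- One call of the subroutine, with the preparation of its arguments: the next `k` values are
computed with the `v` words at `q` as work space. -/
theorem exec_call {Eval : Prog K} {r n k v w : ℕ} {T : ℝ} (hE : Evaluates Eval 10 r n k v T)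
    {F : Polynomial K} {a : ℕ → K} {s pF pA pO pW q L : ℕ} {σ : State K}
    (hF : F.degree < n) (hσ : Progress F a n s pF pA pO pW σ) (hk : σ (.reg 1) = .inr k)
    (hsk : s + k ≤ n) (hbF : pF + n ≤ L) (hbA : pA + n ≤ L) (hbO : pO + n ≤ L)
    (hbq : q + v ≤ L) (hqO : Disjoint (area pO (s + k)) (area q v))
    (hro : Disjoint (area pO n ∪ area pW w) (area pF n ∪ area pA n))
    (hq : area q v ⊆ area pO n ∪ area pW w) {e : IdxExpr}
    (he : ∀ τ : State K, (∀ i, i ∉ ({3, 4, 5} : Set ℕ) → τ (.reg i) = σ (.reg i)) →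
      e.eval τ = some q) :
    ∃ (t : ℕ) (σ' : State K),
      (∀ (rest : Prog K) (t' : ℕ) (σ'' : State K),
        Exec (area pO n ∪ area pW w ∪ regs 0 (max r 10)) L rest σ' t' σ'' →
        Exec (area pO n ∪ area pW w ∪ regs 0 (max r 10)) L
          (.seq (.idx 3 (.add (.reg 7) (.reg 6))) <| .seq (.idx 4 (.add (.reg 8) (.reg 6))) <|
            .seq (.idx 5 e) <| .seq Eval rest) σ (t + t') σ'') ∧
      σ' (.reg 1) = .inr k ∧ (t : ℝ) ≤ T ∧ σ' (.reg 6) = .inr s ∧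
      Progress F a n (s + k) pF pA pO pW (Function.update σ' (.reg 6) (.inr (s + k))) := by
  set τ : State K := Function.update (Function.update (Function.update σ
    (.reg 3) (.inr (pA + s))) (.reg 4) (.inr (pO + s))) (.reg 5) (.inr q) with hτ
  have hword : ∀ x, τ (.word x) = σ (.word x) := fun x => by simp [hτ, Function.update]
  have hsubO : area (pO + s) k ⊆ area pO n := area_subset (by omega) (by omega)
  have hsubW : area (pO + s) k ∪ area q v ⊆ area pO n ∪ area pW w :=
    Set.union_subset (hsubO.trans Set.subset_union_left) hq
  have hcall : IsEvalCall F (fun i => a (s + i)) n k v pF (pA + s) (pO + s) q L τ :=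
    { size := hF
      reg_n := by simpa [hτ, Function.update] using hσ.reg_n
      reg_k := by simpa [hτ, Function.update] using hk
      reg_F := by simpa [hτ, Function.update] using hσ.reg_F
      reg_A := by simp [hτ, Function.update]
      reg_O := by simp [hτ, Function.update]
      reg_W := by simp [hτ]
      coeffs := fun i hi => by rw [hword, hσ.coeffs i hi]
      points := fun i hi => by rw [hword, add_assoc, hσ.points (s + i) (by omega)]
      out_work := hqO.mono_left (area_subset (by omega) (by omega))
      readOnly := hro.mono hsubW
        (Set.union_subset_union_right _ (area_subset (by omega) (by omega)))
      bound_F := hbF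
      bound_A := by omega
      bound_O := by omega
      bound_W := hbq }
  obtain ⟨t, σ', hex, hval, ht⟩ := hE F _ pF (pA + s) (pO + s) q L τ hcall
  -- `Eval` writes no register below 10, so both its arguments and the saved bookkeeping survive the
  -- call.
  have hreg : ∀ i < 10, σ' (.reg i) = τ (.reg i) := fun i hi => hex.frame (by
    rintro ((h | h) | h)
    · exact reg_notMem_area h
    · exact reg_notMem_area h
    · have := (reg_mem_regs.1 h).1; omega)
  have hout : ∀ x, Loc.word x ∉ area (pO + s) k ∪ area q v → σ' (.word x) = σ (.word x) :=
    fun x hx => (hex.frame (by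
      rintro (h | h)
      · exact hx h
      · exact word_notMem_regs h)).trans (hword x)
  have hin : ∀ x, Loc.word x ∈ area pF n ∪ area pA n → σ' (.word x) = σ (.word x) :=
    fun x hx => hout x fun h => Set.disjoint_left.1 hro (hsubW h) hx
  refine ⟨t, σ', fun rest t' σ'' hrest => ?_, ?_, ht, ?_, ?_⟩
  · have h10 : ∀ i < 10, Loc.reg i ∈ area pO n ∪ area pW w ∪ regs 0 (max r 10) := fun i hi =>
      .inr (reg_mem_regs.2 ⟨by omega, by omega⟩)
    refine .idx_seq (v := pA + s) ?_ (by omega) (h10 _ (by omega)) <|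
      .idx_seq (v := pO + s) ?_ (by omega) (h10 _ (by omega)) <|
      -- Registers 3 and 4 are already overwritten when `e` is evaluated, hence the freedom granted
      -- in `he`.
      .idx_seq (v := q) (he _ fun i hi => ?_) (by omega) (h10 _ (by omega)) <|
      .seq _ σ' _ _ _ _ _ (hex.mono ?_) hrest
    · simp [IdxExpr.eval, hσ.reg_A, hσ.reg_s]
    · simp [IdxExpr.eval, hσ.reg_O, hσ.reg_s, Function.update]
    · simp only [Set.mem_insert_iff, Set.mem_singleton_iff, not_or] at hi
      simp [Function.update, hi.1, hi.2.1]
    · refine Set.union_subset_union hsubW ?_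
      rintro _ ⟨i, h₁, h₂, rfl⟩
      exact reg_mem_regs.2 ⟨by omega, by omega⟩
  · rw [hreg 1 (by omega), hcall.reg_k]
  · rw [hreg 6 (by omega)]; simpa [hτ, Function.update] using hσ.reg_s
  · have hreg' : ∀ i < 10, i ∉ ({3, 4, 5, 6} : Set ℕ) →
        Function.update σ' (.reg 6) (.inr (s + k)) (.reg i) = σ (.reg i) := fun i hi h => by
      simp only [Set.mem_insert_iff, Set.mem_singleton_iff, not_or] at h
      simp [Function.update, hreg i hi, h, hτ]
    refine ⟨?_, ?_, ?_, ?_, ?_, ?_, fun i hi => ?_, fun i hi => ?_, fun i hi => ?_⟩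
    · rw [hreg' _ (by omega) (by simp), hσ.reg_n]
    · rw [hreg' _ (by omega) (by simp), hσ.reg_F]
    · simp
    · rw [hreg' _ (by omega) (by simp), hσ.reg_A]
    · rw [hreg' _ (by omega) (by simp), hσ.reg_O]
    · rw [hreg' _ (by omega) (by simp), hσ.reg_W]
    · rw [Function.update_of_ne (by simp),
        hin _ (.inl (word_mem_area.2 ⟨by omega, by omega⟩)), hσ.coeffs i hi]
    · rw [Function.update_of_ne (by simp),
        hin _ (.inr (word_mem_area.2 ⟨by omega, by omega⟩)), hσ.points i hi]
    · rw [Function.update_of_ne (by simp)]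
      rcases lt_or_ge i s with his | his
      · rw [hout, hσ.values i his]
        rintro (h | h)
        · have := word_mem_area.1 h; omega
        · exact Set.disjoint_left.1 hqO (word_mem_area.2 ⟨by omega, by omega⟩) h
      · have := hval (i - s) (by omega)
        rwa [show pO + s + (i - s) = pO + i by omega, show s + (i - s) = i by omega] at this

/-! ### Counting the rounds. -/

/-- A bound for the number of rounds of the loop of `inPlaceEval` when `m` values are missing. -/
noncomputable def roundBound (d m : ℝ) : ℝ :=
  if m < d then 0 else if m < d + 1 then 1 else 2 + Real.logb (d / (d - 1)) (m - d)

theorem one_lt_div_sub_one {d : ℝ} (hd : 1 < d) : 1 < d / (d - 1) :=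
  (one_lt_div (by linarith)).2 (by linarith)

/-- Rounding down costs at most 1 in `k`, which moves the fixed point of the recursion from 0 to
`d`: it is `m - d`, not `m`, that shrinks by the factor `(d - 1) / d`. Once `m < d + 1`, a single
round ends below `d`, since `k ≥ 1`. -/
theorem roundBound_step {d m k : ℝ} (hd : 1 < d) (hm : d ≤ m) (hk : 1 ≤ k) (hmk : m / d - 1 ≤ k) :
    1 + roundBound d (m - k) ≤ roundBound d m := by
  have hb := one_lt_div_sub_one hd
  rcases lt_or_ge m (d + 1) with h | h
  · simp [roundBound, show m - k < d by linarith, hm.not_gt, h]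
  · have hlog : 0 ≤ Real.logb (d / (d - 1)) (m - d) := Real.logb_nonneg hb (by linarith)
    simp only [roundBound, hm.not_gt, h.not_gt, if_false]
    split_ifs with h₁ h₂
    · linarith
    · linarith
    · have h₃ : (m - k - d) * (d / (d - 1)) ≤ m - d := by
        rw [← mul_div_assoc, div_le_iff₀ (by linarith)]
        have : m - d - k * d ≤ 0 := by
          have := (sub_le_iff_le_add.1 hmk)
          rw [div_le_iff₀ (by linarith)] at this
          linarith
        linarith
      have h₄ := Real.logb_le_logb_of_le hb (by nlinarith) h₃
      rw [Real.logb_mul (by linarith) (by linarith),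
        Real.logb_self_eq_one hb] at h₄
      linarith

theorem roundBound_le {d m : ℝ} (hd : 1 < d) (hm : 1 ≤ m) :
    roundBound d m ≤ 2 + Real.logb (d / (d - 1)) m := by
  have hb := one_lt_div_sub_one hd
  have := Real.logb_nonneg hb hm
  unfold roundBound
  split_ifs with h₁ h₂
  · linarith
  · linarith
  · have := Real.logb_le_logb_of_le hb (show 0 < m - d by linarith) (show m - d ≤ m by linarith)
    linarith

/-! ### The loop and the whole algorithm. -/

theorem Evaluates.mono_time {P : Prog K} {lo hi n k w : ℕ} {T T' : ℝ}
    (h : Evaluates P lo hi n k w T) (hT : T ≤ T') : Evaluates P lo hi n k w T' := by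
  intro F a pF pA pO pW L σ hσ
  obtain ⟨t, σ', h₁, h₂, h₃⟩ := h F a pF pA pO pW L σ hσ
  exact ⟨t, σ', h₁, h₂, h₃.trans hT⟩

theorem Progress.update_reg_one {F : Polynomial K} {a : ℕ → K} {n s pF pA pO pW : ℕ} {σ : State K}
    (h : Progress F a n s pF pA pO pW σ) (x : K ⊕ ℕ) :
    Progress F a n s pF pA pO pW (Function.update σ (.reg 1) x) := by
  obtain ⟨h₁, h₂, h₃, h₄, h₅, h₆, h₇, h₈, h₉⟩ := h
  constructor <;> simpa [Function.update]

/-- The work space of a round fits into the part of the output area that is still free. -/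
theorem add_floor_le {c : ℝ} (hc : 0 ≤ c) (m : ℕ) :
    ⌊(m : ℝ) / (c + 3)⌋₊ + ⌊(c + 2) * (⌊(m : ℝ) / (c + 3)⌋₊ : ℕ)⌋₊ ≤ m := by
  have h₁ : (⌊(m : ℝ) / (c + 3)⌋₊ : ℝ) ≤ m / (c + 3) := Nat.floor_le (by positivity)
  have h₂ := Nat.floor_le (show 0 ≤ (c + 2) * (⌊(m : ℝ) / (c + 3)⌋₊ : ℝ) by positivity)
  rw [le_div_iff₀ (by linarith)] at h₁
  rify
  linarith

/-- The loop of `inPlaceEval` halts after `j` rounds with fewer than `c + 3` values missing. -/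
theorem exec_loop {Eval : Prog K} {r n w : ℕ} {c D G : ℝ} (hc : 0 ≤ c)
    (hE : ∀ k : ℕ, 1 ≤ k → k ≤ n → Evaluates Eval 10 r n k ⌊(c + 2) * k⌋₊ (D + G * k))
    {F : Polynomial K} {a : ℕ → K} {pF pA pO pW L : ℕ}
    (hF : F.degree < n) (hbF : pF + n ≤ L) (hbA : pA + n ≤ L) (hbO : pO + n ≤ L)
    (hro : Disjoint (area pO n ∪ area pW w) (area pF n ∪ area pA n))
    (m : ℕ) (s : ℕ) (σ : State K) (hms : s + m = n) (hm : 0 < m)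
    (hσ : Progress F a n s pF pA pO pW σ) (hk : σ (.reg 1) = .inr ⌊(m : ℝ) / (c + 3)⌋₊) :
    ∃ (t m' s' j : ℕ) (σ' : State K),
      Exec (area pO n ∪ area pW w ∪ regs 0 (max r 10)) L
        (.whileLt (.const 0) (.reg 1) (block [
          .idx 3 (.add (.reg 7) (.reg 6)),
          .idx 4 (.add (.reg 8) (.reg 6)),
          .idx 5 (.add (.add (.reg 8) (.reg 6)) (.reg 1)),
          Eval,
          .idx 6 (.add (.reg 6) (.reg 1)),
          .idx 1 (.floorDiv (.sub (.reg 0) (.reg 6)) (c + 3))])) σ t σ' ∧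
      Progress F a n s' pF pA pO pW σ' ∧ s' + m' = n ∧ 0 < m' ∧ (m' : ℝ) < c + 3 ∧
      (t : ℝ) ≤ D * j + G * (s' - s) ∧ (j : ℝ) ≤ roundBound (c + 3) m := by
  induction m using Nat.strong_induction_on generalizing s σ with
  | _ m ih =>
    set k := ⌊(m : ℝ) / (c + 3)⌋₊ with hkdef
    rcases Nat.eq_zero_or_pos k with hk0 | hk1
    · have hmc : (m : ℝ) < c + 3 := by
        have := Nat.floor_eq_zero.1 (hkdef.symm.trans hk0)
        rwa [div_lt_one (by linarith)] at this
      refine ⟨0, m, s, 0, σ, .while_false σ _ _ _ 0 k (by simp [IdxExpr.eval])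
        (by simp [IdxExpr.eval, hk]) (by omega), hσ, hms, hm, hmc, by simp, ?_⟩
      simp [roundBound, hmc]
    · have hfit : k + ⌊(c + 2) * (k : ℕ)⌋₊ ≤ m := add_floor_le hc m
      -- At least one value stays missing, so the last call has at least one point, as the
      -- assumption on `Eval` demands.
      have hkm : k < m := by
        have : k ≤ ⌊(c + 2) * (k : ℝ)⌋₊ := Nat.le_floor (by nlinarith [Nat.cast_nonneg (α := ℝ) k])
        omega
      obtain ⟨t₁, σ₁, hrun, hσk, ht₁, hσs, hprog⟩ := exec_call (w := w) (q := pO + s + k)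
        (e := .add (.add (.reg 8) (.reg 6)) (.reg 1)) (hE k hk1 (by omega)) hF hσ hk (by omega)
        hbF hbA hbO (by omega) (area_disjoint_of_le (by omega)) hro
        ((area_subset (by omega) (by omega)).trans Set.subset_union_left)
        (fun τ hτ => by
          have h8 := hτ 8 (by simp)
          have h6 := hτ 6 (by simp)
          have h1 := hτ 1 (by simp)
          simp [IdxExpr.eval, h8, h6, h1, hσ.reg_O, hσ.reg_s, hk])
      obtain ⟨t₂, m', s', j, σ', hex, hprog', hms', hm', hmc', ht₂, hj⟩ :=
        ih (m - k) (by omega) (s + k) _ (by omega) (by omega)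
          (hprog.update_reg_one (.inr ⌊((m - k : ℕ) : ℝ) / (c + 3)⌋₊)) (by simp)
      refine ⟨t₁ + t₂, m', s', j + 1, σ', ?_, hprog', hms', hm', hmc', ?_, ?_⟩
      · refine .while_true σ _ σ' _ _ _ t₁ t₂ 0 k (by simp [IdxExpr.eval])
          (by simp [IdxExpr.eval, hk]) hk1 (hrun _ 0 _ ?_) hex
        have hreg : ∀ i < 10, Loc.reg i ∈ area pO n ∪ area pW w ∪ regs 0 (max r 10) :=
          fun i hi => .inr (reg_mem_regs.2 ⟨by omega, by omega⟩)
        refine .idx_seq (v := s + k) ?_ (by omega) (hreg _ (by omega)) <|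
          .idx_seq (v := ⌊((m - k : ℕ) : ℝ) / (c + 3)⌋₊) ?_ ?_ (hreg _ (by omega)) (.skip _)
        · simp [IdxExpr.eval, hσs, hσk]
        · have h0 := hprog.reg_n
          have h6 := hprog.reg_s
          simp only [IdxExpr.eval, h0, h6]
          simp [show n - (s + k) = m - k by omega]
        · have := add_floor_le hc (m - k)
          omega
      · push_cast at ht₂ ⊢
        linarith
      · have h₁ := Nat.lt_floor_add_one ((m : ℝ) / (c + 3))
        have h₂ : (k : ℝ) ≤ m / (c + 3) := Nat.floor_le (by positivity)
        have h₃ : (1 : ℝ) ≤ k := by exact_mod_cast hk1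
        have h₄ : c + 3 ≤ m := by
          have := h₃.trans h₂
          rwa [le_div_iff₀ (by linarith), one_mul] at this
        have := roundBound_step (by linarith) h₄ h₃ (by linarith)
        rw [Nat.cast_sub hkm.le] at hj
        push_cast
        linarith

/-- The 3 is the 2 of `roundBound_le` plus the call after the loop; fewer than `c + 3` points remain
for that call, which bounds its work space. -/
theorem evaluates_inPlaceEval {Eval : Prog K} {r n : ℕ} {c D G : ℝ} (hc : 0 ≤ c) (hD : 0 ≤ D)
    (hn : 1 ≤ n)
    (hE : ∀ k : ℕ, 1 ≤ k → k ≤ n → Evaluates Eval 10 r n k ⌊(c + 2) * k⌋₊ (D + G * k)) :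
    Evaluates (inPlaceEval c Eval) 0 (max r 10) n n ⌊(c + 2) * (c + 3)⌋₊
      (D * (3 + Real.logb ((c + 3) / (c + 2)) n) + G * n) := by
  intro F a pF pA pO pW L σ hσ
  set w := ⌊(c + 2) * (c + 3)⌋₊
  have hreg : ∀ i < 10, Loc.reg i ∈ area pO n ∪ area pW w ∪ regs 0 (max r 10) :=
    fun i hi => .inr (reg_mem_regs.2 ⟨by omega, by omega⟩)
  have hbF := hσ.bound_F
  have hbA := hσ.bound_A
  have hbO := hσ.bound_O
  have hbW := hσ.bound_W
  set σ₀ : State K := Function.update (Function.update (Function.update (Function.update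
    (Function.update σ (.reg 7) (.inr pA)) (.reg 8) (.inr pO)) (.reg 9) (.inr pW))
    (.reg 6) (.inr 0)) (.reg 1) (.inr ⌊(n : ℝ) / (c + 3)⌋₊) with hσ₀
  have hprog : Progress F a n 0 pF pA pO pW σ₀ := by
    refine ⟨?_, ?_, ?_, ?_, ?_, ?_, fun i hi => ?_, fun i hi => ?_, fun i hi => by omega⟩
    · simpa [hσ₀, Function.update] using hσ.reg_n
    · simpa [hσ₀, Function.update] using hσ.reg_F
    · simp [hσ₀, Function.update]
    · simp [hσ₀, Function.update]
    · simp [hσ₀, Function.update]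
    · simp [hσ₀, Function.update]
    · simpa [hσ₀, Function.update] using hσ.coeffs i hi
    · simpa [hσ₀, Function.update] using hσ.points i hi
  obtain ⟨t₁, m, s, j, σ₁, hloop, hprog₁, hms, hm, hmc, ht₁, hj⟩ :=
    exec_loop (w := w) hc hE hσ.size hbF hbA hbO hσ.readOnly n 0 σ₀ (by omega) hn hprog
      (by simp [hσ₀])
  have hv : ⌊(c + 2) * (m : ℝ)⌋₊ ≤ w :=
    Nat.floor_le_floor (mul_le_mul_of_nonneg_left hmc.le (by linarith))
  obtain ⟨t₂, σ₂, hrun, -, ht₂, -, hprog₂⟩ := exec_call (w := w) (q := pW)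
    (e := .reg 9) (hE m hm (by omega)) hσ.size (hprog₁.update_reg_one (.inr m)) (by simp)
    (by omega) hbF hbA hbO (by omega)
    (hσ.out_work.mono (area_subset (by omega) (by omega)) (area_subset (by omega) (by omega)))
    hσ.readOnly ((area_subset (by omega) (by omega)).trans Set.subset_union_right)
    (fun τ hτ => by
      have h9 := hτ 9 (by simp)
      simp [IdxExpr.eval, h9, hprog₁.reg_W, Function.update])
  refine ⟨t₁ + (t₂ + 0), σ₂, ?_, fun i hi => ?_, ?_⟩
  · refine .idx_seq (v := pA) ?_ (by omega) (hreg _ (by omega)) <|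
      .idx_seq (v := pO) ?_ (by omega) (hreg _ (by omega)) <|
      .idx_seq (v := pW) ?_ (by omega) (hreg _ (by omega)) <|
      .idx_seq (v := 0) ?_ (by omega) (hreg _ (by omega)) <|
      .idx_seq (v := ⌊(n : ℝ) / (c + 3)⌋₊) ?_ ?_ (hreg _ (by omega)) <|
      .seq _ σ₁ _ _ _ _ _ hloop <|
      .idx_seq (v := m) ?_ (by omega) (hreg _ (by omega)) <| hrun _ 0 _ (.skip _)
    · simp [IdxExpr.eval, hσ.reg_A]
    · simp [IdxExpr.eval, hσ.reg_O, Function.update]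
    · simp [IdxExpr.eval, hσ.reg_W, Function.update]
    · simp [IdxExpr.eval]
    · simp [IdxExpr.eval, hσ.reg_n, Function.update]
    · have := add_floor_le hc n
      omega
    · simp [IdxExpr.eval, hprog₁.reg_n, hprog₁.reg_s, ← hms]
  -- Register 6 is not advanced after the last call; the invariant holds for the state with it
  -- advanced, which has the same memory words.
  · simpa using hprog₂.values i (by omega)
  · have h₁ := roundBound_le (d := c + 3) (m := n) (by linarith) (by exact_mod_cast hn)
    rw [show c + 3 - 1 = c + 2 by ring] at h₁
    have h₂ : (n : ℝ) = s + m := by rw [← hms]; push_cast; ring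
    have h₃ := mul_le_mul_of_nonneg_left (hj.trans h₁) hD
    have h₄ : G * n = G * s + G * m := by rw [h₂]; ring
    push_cast at ht₁ ⊢
    linarith

/-! ### Asymptotics and the cost of one call. -/

theorem isBigO_self_mul_logb_logb {M : ℕ → ℝ} :
    M =O[Filter.atTop] (fun n : ℕ => M n * Real.logb 2 (Real.logb 2 n)) := by
  have h : Filter.Tendsto (fun n : ℕ => Real.logb 2 (Real.logb 2 n)) Filter.atTop Filter.atTop :=
    (Real.tendsto_logb_atTop one_lt_two).comp
      ((Real.tendsto_logb_atTop one_lt_two).comp tendsto_natCast_atTop_atTop)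
  refine .of_bound 1 ?_
  filter_upwards [h.eventually_ge_atTop 1] with n hn
  rw [norm_mul, one_mul, Real.norm_of_nonneg (by linarith : 0 ≤ Real.logb 2 (Real.logb 2 n))]
  exact le_mul_of_one_le_right (norm_nonneg _) hn

theorem isBigO_natCast_mul_logb :
    (fun n : ℕ => (n : ℝ)) =O[Filter.atTop] (fun n : ℕ => (n : ℝ) * Real.logb 2 n) := by
  refine .of_bound 1 ?_
  filter_upwards [((Real.tendsto_logb_atTop one_lt_two).comp
    tendsto_natCast_atTop_atTop).eventually_ge_atTop 1] with n hn
  simp only [Function.comp_apply] at hn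
  rw [norm_mul, one_mul, Real.norm_of_nonneg (by linarith : 0 ≤ Real.logb 2 (n : ℝ))]
  exact le_mul_of_one_le_right (norm_nonneg _) hn

theorem logb_two_natCast_nonneg (n : ℕ) : 0 ≤ Real.logb 2 n := by
  rcases Nat.eq_zero_or_pos n with rfl | h
  · simp
  · exact Real.logb_nonneg one_lt_two (by exact_mod_cast h)

theorem logb_two_logb_two_nonneg (n : ℕ) : 0 ≤ Real.logb 2 (Real.logb 2 n) := by
  rcases lt_or_ge n 2 with h | h
  -- For `n = 0, 1` the inner logarithm is 0, and `Real.logb 2 0 = 0` by convention.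
  · interval_cases n <;> simp
  · refine Real.logb_nonneg one_lt_two ?_
    rw [Real.le_logb_iff_rpow_le one_lt_two (by positivity)]
    simpa using (by exact_mod_cast h : (2 : ℝ) ≤ n)

theorem logb_two_logb_two_mono {k n : ℕ} (h : k ≤ n) :
    Real.logb 2 (Real.logb 2 k) ≤ Real.logb 2 (Real.logb 2 n) := by
  rcases lt_or_ge k 2 with hk | hk
  · refine le_trans (le_of_eq ?_) (logb_two_logb_two_nonneg n)
    interval_cases k <;> simp
  · have h2 : (1 : ℝ) < k := by exact_mod_cast hk
    exact Real.logb_le_logb_of_le one_lt_two (Real.logb_pos one_lt_two h2)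
      (Real.logb_le_logb_of_le one_lt_two (by linarith) (by exact_mod_cast h))

/-- Superlinearity turns the bound for one call into an affine function of `k`. -/
theorem cost_le_affine {M : ℕ → ℝ} (hM0 : ∀ n, 0 ≤ M n)
    (hM : ∀ (α : ℝ) (n m : ℕ), 1 ≤ α → 1 ≤ n → (m : ℝ) = α * n → α * M n ≤ M m)
    (lam C : ℝ) {n k : ℕ} (hk : 1 ≤ k) (hkn : k ≤ n) :
    2 * lam * M n + 4 * M k * Real.logb 2 k + C * (n + M k * Real.logb 2 (Real.logb 2 k)) ≤
      (2 * lam * M n + |C| * n) +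
        (4 * Real.logb 2 n + |C| * Real.logb 2 (Real.logb 2 n)) * M n / n * k := by
  have hk0 : (0 : ℝ) < k := by exact_mod_cast hk
  have hn0 : (0 : ℝ) < n := by exact_mod_cast hk.trans hkn
  have hkn' : (k : ℝ) ≤ n := by exact_mod_cast hkn
  -- Superlinearity with `α = n / k`.
  have hMk : M k ≤ M n / n * k := by
    have := hM (n / k) k n ((one_le_div hk0).2 hkn') hk (by field_simp)
    rw [div_mul_eq_mul_div, div_le_iff₀ hk0] at this
    rw [div_mul_eq_mul_div, le_div_iff₀ hn0]
    linarith
  have hl : M k * Real.logb 2 k ≤ M n / n * k * Real.logb 2 n :=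
    mul_le_mul hMk (Real.logb_le_logb_of_le one_lt_two hk0 hkn') (logb_two_natCast_nonneg k)
      ((hM0 k).trans hMk)
  have hll : M k * Real.logb 2 (Real.logb 2 k) ≤ M n / n * k * Real.logb 2 (Real.logb 2 n) :=
    mul_le_mul hMk (logb_two_logb_two_mono hkn) (logb_two_logb_two_nonneg k) ((hM0 k).trans hMk)
  have hC : C * (n + M k * Real.logb 2 (Real.logb 2 k)) ≤
      |C| * (n + M n / n * k * Real.logb 2 (Real.logb 2 n)) :=
    (mul_le_mul_of_nonneg_right (le_abs_self C) (add_nonneg hn0.le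
      (mul_nonneg (hM0 k) (logb_two_logb_two_nonneg k)))).trans
      (mul_le_mul_of_nonneg_left (by linarith) (abs_nonneg C))
  calc _ ≤ 2 * lam * M n + 4 * (M n / n * k * Real.logb 2 n) +
        |C| * (n + M n / n * k * Real.logb 2 (Real.logb 2 n)) := by linarith
    _ = _ := by ring

end InPlace

theorem mainTheorem5 {K : Type*} [CommRing K] (M : ℕ → ℝ) (lam c : ℝ)
    (hlam : 0 ≤ lam) (hc : 0 ≤ c) (hM0 : ∀ n, 0 ≤ M n)
    (hM : ∀ (α : ℝ) (n m : ℕ), 1 ≤ α → 1 ≤ n → (m : ℝ) = α * n → α * M n ≤ M m)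
    (hMlog : (fun n : ℕ => (n : ℝ) * Real.logb 2 n) =O[Filter.atTop]
      (fun n : ℕ => M n * Real.logb 2 (Real.logb 2 n)))
    (Eval : InPlace.Prog K) (r : ℕ) (C : ℝ)
    (hEval : ∀ n k : ℕ, 1 ≤ k → k ≤ n →
      InPlace.Evaluates Eval 10 r n k ⌊(c + 2) * k⌋₊
        (2 * lam * M n + 4 * M k * Real.logb 2 k
          + C * (n + M k * Real.logb 2 (Real.logb 2 k)))) :
    ∃ (r' w : ℕ) (E : ℕ → ℝ),
      E =O[Filter.atTop] (fun n : ℕ => M n * Real.logb 2 (Real.logb 2 n)) ∧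
      ∀ n : ℕ, 1 ≤ n →
        InPlace.Evaluates (InPlace.inPlaceEval c Eval) 0 r' n n w
          ((4 + 2 * lam / Real.logb 2 ((c + 3) / (c + 2))) * M n * Real.logb 2 n + E n) := by
  -- The error collects `3 * D`, the `|C| * n` part of `D` times the logarithmic number of rounds,
  -- and the iterated-logarithm part of `G * n`.
  refine ⟨max r 10, ⌊(c + 2) * (c + 3)⌋₊, fun n => 6 * lam * M n + 3 * |C| * n +
    |C| / Real.logb 2 ((c + 3) / (c + 2)) * (n * Real.logb 2 n) +
    |C| * (M n * Real.logb 2 (Real.logb 2 n)), ?_, fun n hn => ?_⟩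
  · exact (((InPlace.isBigO_self_mul_logb_logb.const_mul_left _).add
      ((InPlace.isBigO_natCast_mul_logb.trans hMlog).const_mul_left _)).add
      (hMlog.const_mul_left _)).add ((Asymptotics.isBigO_refl _ _).const_mul_left _)
  · refine (InPlace.evaluates_inPlaceEval hc
      (add_nonneg (mul_nonneg (by linarith) (hM0 n))
        (mul_nonneg (abs_nonneg C) n.cast_nonneg)) hn fun k hk hkn =>
      (hEval n k hk hkn).mono_time
        (InPlace.cost_le_affine hM0 hM lam C hk hkn)).mono_time (le_of_eq ?_)
    have hn0 : (n : ℝ) ≠ 0 := by positivity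
    have hlog : Real.logb ((c + 3) / (c + 2)) n =
        Real.logb 2 n / Real.logb 2 ((c + 3) / (c + 2)) :=
      (div_div_div_cancel_right₀ (Real.log_pos one_lt_two).ne' _ _).symm
    rw [hlog, div_mul_cancel₀ _ hn0]
    ring
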